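/- **Theorem 4.4 (classification of relations for $p=3$, $g=2$).** For $\varepsilon,\varepsilon'\in\mathbb R^2$, $z\in\mathbb C^2$ and $\tau\in\mathbf H_2$ (symmetric complex $2\times2$ matrices with positive definite imaginary part) put $$\Theta\begin{bmatrix}\varepsilon\\ \varepsilon'\end{bmatrix}(z,\tau)=\sum_{l\in\mathbb Z^2}\exp 2\pi i\Big\{\tfrac12\big(l+\tfrac{\varepsilon}{2}\big)^t\tau\big(l+\tfrac{\varepsilon}{2}\big)+\big(l+\tfrac{\varepsilon}{2}\big)^t\big(z+\tfrac{\varepsilon'}{2}\big)\Big\}.$$ Write $0=\begin{bmatrix}0\\0\end{bmatrix}$, $1=\begin{bmatrix}1\\0\end{bmatrix}$, $2=\begin{bmatrix}0\\1\end{bmatrix}$, $3=\begin{bmatrix}1\\1\end{bmatrix}$, and let $\Theta_{ij}$ be the theta function whose characteristic has first column $i$ and second column $j$. The characteristic is called even if $\varepsilon'^t\varepsilon$ is even. The ten even characteristics are $00$ and the nine entries of $$A=\begin{pmatrix}11&01&10\\22&20&02\\33&21&12\end{pmatrix}.$$ For an even characteristic $m$ put $X_m(\tau)=\Theta_m(0,\tau)\,\Theta_m(0,3\tau)$.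 Then: * **Type I.** For every generalized diagonal of $A$, i.e. every permutation $\sigma$ of the set of the three indices, $X_{00}(\tau)=\sum_{i}X_{A_{i\sigma(i)}}(\tau)$ for all $\tau\in\mathbf H_2$. For example $X_{00}=X_{11}+X_{20}+X_{12}$. * **Type II.** For every $2\times2$ submatrix of $A$, i.e. all $i\ne k$ and $j\ne l$, $X_{A_{ij}}(\tau)+X_{A_{kl}}(\tau)=X_{A_{il}}(\tau)+X_{A_{kj}}(\tau)$ for all $\tau\in\mathbf H_2$. For example $X_{11}+X_{20}=X_{01}+X_{22}$. * **Completeness.** These two types account for all linear relations: a family of complex constants $(c_m)_m$, indexed by the ten even characteristics, satisfies $\sum_m c_mX_m(\tau)=0$ for all $\tau\in\mathbf H_2$ if and only if it is a complex linear combination of the coefficient vectors of the relations of types I and II. -/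

import Mathlib

/-- The Siegel upper half space `H_g`: symmetric complex `g × g` matrices whose imaginary part is
positive definite. -/
def SiegelHalfSpace (g : ℕ) : Set (Matrix (Fin g) (Fin g) ℂ) :=
  {τ | τ.IsSymm ∧ (τ.map Complex.im).PosDef}

/-- The general term, at `l ∈ ℤ^g`, of the theta series with characteristic `[ε; ε']`:
`exp (2πi {½ (l + ε/2)ᵗ τ (l + ε/2) + (l + ε/2)ᵗ (z + ε'/2)})`. -/
noncomputable def thetaTerm {g : ℕ} (ε ε' : Fin g → ℝ) (z : Fin g → ℂ)
    (τ : Matrix (Fin g) (Fin g) ℂ) (l : Fin g → ℤ) : ℂ :=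
  Complex.exp (2 * Real.pi * Complex.I *
    ((1 / 2 : ℂ) * ∑ j, ∑ k, ((l j : ℂ) + (ε j : ℂ) / 2) * τ j k * ((l k : ℂ) + (ε k : ℂ) / 2)
      + ∑ j, ((l j : ℂ) + (ε j : ℂ) / 2) * (z j + (ε' j : ℂ) / 2)))

/-- The theta function `Θ[ε; ε'](z, τ)` with real characteristic. The series is absolutely
convergent for `τ ∈ H_g`. -/
noncomputable def theta {g : ℕ} (ε ε' : Fin g → ℝ) (z : Fin g → ℂ)
    (τ : Matrix (Fin g) (Fin g) ℂ) : ℂ :=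
  ∑' l : Fin g → ℤ, thetaTerm ε ε' z τ l

/-- Upper entries of the four columns `0 = [0; 0]`, `1 = [1; 0]`, `2 = [0; 1]`, `3 = [1; 1]`. -/
def colUpper : Fin 4 → ℤ := ![0, 1, 0, 1]

/-- Lower entries of the four columns `0 = [0; 0]`, `1 = [1; 0]`, `2 = [0; 1]`, `3 = [1; 1]`. -/
def colLower : Fin 4 → ℤ := ![0, 0, 1, 1]

/-- The upper row `ε` of the characteristic `ij`, whose columns are the columns `i` and `j`. -/
def upperRow (i j : Fin 4) : Fin 2 → ℤ := ![colUpper i, colUpper j]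

/-- The lower row `ε'` of the characteristic `ij`. -/
def lowerRow (i j : Fin 4) : Fin 2 → ℤ := ![colLower i, colLower j]

/-- The theta constant `Θ_{ij}(0, τ)`. -/
noncomputable def thetaConst (i j : Fin 4) (τ : Matrix (Fin 2) (Fin 2) ℂ) : ℂ :=
  theta (fun k => (upperRow i j k : ℝ)) (fun k => (lowerRow i j k : ℝ)) 0 τ

/-- The characteristic `ij` is even: `ε'ᵗ ε` is even. -/
abbrev IsEvenChar (m : Fin 4 × Fin 4) : Prop :=
  Even (∑ k, lowerRow m.1 m.2 k * upperRow m.1 m.2 k)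

/-- The even characteristics `ij` in genus two (there are ten of them). -/
abbrev EvenChar : Type := {m : Fin 4 × Fin 4 // IsEvenChar m}

/-- The product `Θ_{ij}(0, τ) Θ_{ij}(0, 3τ)`, for an even characteristic `ij`. -/
noncomputable def thetaProd (m : EvenChar) (τ : Matrix (Fin 2) (Fin 2) ℂ) : ℂ :=
  thetaConst m.1.1 m.1.2 τ * thetaConst m.1.1 m.1.2 ((3 : ℂ) • τ)

/-- The even characteristic `00`. -/
def char00 : EvenChar := ⟨(0, 0), by decide⟩

/-- The matrix `A` of the nine even characteristics other than `00`. -/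
def matA : Matrix (Fin 3) (Fin 3) EvenChar :=
  !![⟨(1, 1), by decide⟩, ⟨(0, 1), by decide⟩, ⟨(1, 0), by decide⟩;
     ⟨(2, 2), by decide⟩, ⟨(2, 0), by decide⟩, ⟨(0, 2), by decide⟩;
     ⟨(3, 3), by decide⟩, ⟨(2, 1), by decide⟩, ⟨(1, 2), by decide⟩]

/-- The coefficient vector `c` is a (linear) relation among the ten products:
`∑ c_m Θ_m(0, τ) Θ_m(0, 3τ) = 0` identically in `τ ∈ H_2`. -/
def IsThetaRelation (c : EvenChar → ℂ) : Prop :=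
  ∀ τ ∈ SiegelHalfSpace 2, ∑ m, c m * thetaProd m τ = 0

/-- Coefficient vector of the type I relation attached to the generalized diagonal
`A 0 (σ 0), A 1 (σ 1), A 2 (σ 2)`: the characteristic `00` on one side, the diagonal on the
other. -/
def typeI (σ : Equiv.Perm (Fin 3)) : EvenChar → ℂ :=
  Pi.single char00 1 - ∑ i, Pi.single (matA i (σ i)) 1

/-- Coefficient vector of the type II relation attached to the `2 × 2` submatrix of `A` with rows
`i, k` and columns `j, l`: the two entries of one diagonal on one side, those of the other diagonal
on the other. -/
def typeII (i k j l : Fin 3) : EvenChar → ℂ :=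
  Pi.single (matA i j) 1 + Pi.single (matA k l) 1
    - (Pi.single (matA i l) 1 + Pi.single (matA k j) 1)

/-!
The product `Θ_m(0, τ) Θ_m(0, 3τ)` is a sum over pairs `(a, b)` in `(ℤ² + ε/2)²` of
`exp (πi (τ[a] + 3 τ[b]))` times the sign `(-1) ^ ((a + b) · ε')`, where `τ[a]` is the value of the
quadratic form of `τ` at `a`. Since `a² + 3 b²` is the norm of
`a + b √-3`, the vector `v = a + b √-3` ranges over pairs of Eisenstein integers
`v = x + y ω` with `x = a + b` and `y = 2 b`, so `y ≡ ε` modulo `2`. All ten products are thus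
theta series of one lattice `ℤ[ω]²`, weighted by functions `charWeight m` of the class of `v` in
`𝔽₄² = ℤ[ω]² / 2` (`thetaConst_mul_thetaConst_eq_latticeSum`).

The exponential depends on `v` only through `|v₁|²`, `|v₂|²` and `|v₁ - v₂|²`, hence is invariant
under simultaneous multiplication by `ω` and under conjugation. A weight may therefore be replaced
by its sum over the orbits of the group of order six these generate (`latticeSum_orbitSum`). There
are five orbits on `𝔽₄²`: zero, and those of `(1, 0)`, `(0, 1)`, `(1, 1)` and `(1, ω)`. Ten weights
thus become ten functions on five points, and the relations of types I and II are relations between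
these functions, checked on the finite set `𝔽₄²`.

Conversely the five orbit series are linearly independent. Along a ray `τ = i t Y` with `t → ∞`
the smallest exponent dominates, and suitable forms `Y` isolate the orbits one after another
(`eq_zero_of_latticeSum_eq_zero`). So in any relation `c` the orbit sums of the combined weight
vanish (`forall_orbitSum_of_isThetaRelation`): five linear equations, which say that all
row and column sums of `(c (A i j))` equal `-c 00`, and such vectors are combinations of the two
types (`mem_span_of_forall_orbitSum`).
-/

/-! ### Weights on pairs of Eisenstein integers modulo two -/

/-- Pairs `(x₁ + y₁ ω, x₂ + y₂ ω)` with coordinates in `R`, where `ω² + ω + 1 = 0`. For `R = ℤ`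
these are pairs of Eisenstein integers, for `R = ZMod 2` pairs of elements of `𝔽₄`. -/
abbrev EisPair (R : Type*) : Type _ := (R × R) × (R × R)

section Eisenstein

variable {R : Type*} [CommRing R]

/-- Multiplication by `ω`, on the element `x + y ω` written as the pair `(x, y)`. -/
def eisMul (u : R × R) : R × R := (-u.2, u.1 - u.2)

/-- Complex conjugation, on the element `x + y ω` written as the pair `(x, y)`. -/
def eisConj (u : R × R) : R × R := (u.1 - u.2, -u.2)

/-- The norm `x² - xy + y²` of the element `x + y ω`. -/
def eisNorm (u : R × R) : R := u.1 ^ 2 - u.1 * u.2 + u.2 ^ 2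

end Eisenstein

/-- Sum of `φ` over the six images of `w` under the group generated by simultaneous multiplication
by `ω` and simultaneous conjugation of both components. -/
def orbitSum {R : Type*} [CommRing R] {M : Type*} [Add M]
    (φ : EisPair R → M) (w : EisPair R) : M :=
  φ w + φ (Prod.map eisMul eisMul w) + φ (Prod.map eisMul eisMul (Prod.map eisMul eisMul w))
    + (φ (Prod.map eisConj eisConj w) + φ (Prod.map eisConj eisConj (Prod.map eisMul eisMul w))
      + φ (Prod.map eisConj eisConj (Prod.map eisMul eisMul (Prod.map eisMul eisMul w))))

/-- The weight by which the class `w` of `x + y ω` in `𝔽₄²` enters the theta product with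
characteristic `m = [ε; ε']`: the sign `(-1) ^ (x · ε')` if `y = ε`, and `0` otherwise. -/
def charWeight (m : Fin 4 × Fin 4) (w : EisPair (ZMod 2)) : ℤ :=
  if w.1.2 = (colUpper m.1 : ZMod 2) ∧ w.2.2 = (colUpper m.2 : ZMod 2) then
    if (colLower m.1 : ZMod 2) * w.1.1 + (colLower m.2 : ZMod 2) * w.2.1 = 0 then 1 else -1
  else 0

/-- The orbit sums of the weights of `A i j` have the form `r i + s j`. -/
theorem orbitSum_charWeight_matA (i j : Fin 3) (w : EisPair (ZMod 2)) :
    orbitSum (charWeight (matA i j).1) w + orbitSum (charWeight (matA 0 0).1) w =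
      orbitSum (charWeight (matA i 0).1) w + orbitSum (charWeight (matA 0 j).1) w := by
  revert i j w; decide +kernel

theorem orbitSum_charWeight_char00 (w : EisPair (ZMod 2)) :
    orbitSum (charWeight char00.1) w = ∑ i, orbitSum (charWeight (matA i i).1) w := by
  revert w; decide +kernel

/-! The orbit sum of a weight is constant on each of the four nonzero orbits, which are singled out
by norms: an element of `𝔽₄` has norm `1` exactly when it is nonzero. -/

theorem orbitSum_charWeight_left (m : EvenChar) (w : EisPair (ZMod 2)) :
    eisNorm w.1 = 1 → w.2 = 0 →
      orbitSum (charWeight m.1) w = orbitSum (charWeight m.1) ((1, 0), (0, 0)) := by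
  revert m w; decide +kernel

theorem orbitSum_charWeight_right (m : EvenChar) (w : EisPair (ZMod 2)) :
    eisNorm w.2 = 1 → w.1 = 0 →
      orbitSum (charWeight m.1) w = orbitSum (charWeight m.1) ((0, 0), (1, 0)) := by
  revert m w; decide +kernel

theorem orbitSum_charWeight_diag (m : EvenChar) (w : EisPair (ZMod 2)) :
    eisNorm w.1 = 1 → w.1 = w.2 →
      orbitSum (charWeight m.1) w = orbitSum (charWeight m.1) ((1, 0), (1, 0)) := by
  revert m w; decide +kernel

/-- Among all pairs, the sum of the three norms is `1` exactly on the orbit of `(1, ω)`, where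
both components and their difference are nonzero. -/
theorem orbitSum_charWeight_generic (m : EvenChar)
    (w : EisPair (ZMod 2)) :
    eisNorm w.1 + eisNorm w.2 + eisNorm (w.1 - w.2) = 1 →
      orbitSum (charWeight m.1) w = orbitSum (charWeight m.1) ((1, 0), (0, 1)) := by
  revert m w; decide +kernel

/-- The five orbits exhaust `𝔽₄²`. -/
theorem eisNorm_cases (w : EisPair (ZMod 2)) :
    w = 0 ∨ (eisNorm w.1 = 1 ∧ w.2 = 0) ∨ (eisNorm w.2 = 1 ∧ w.1 = 0) ∨
      (eisNorm w.1 = 1 ∧ w.1 = w.2) ∨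
      eisNorm w.1 + eisNorm w.2 + eisNorm (w.1 - w.2) = 1 := by
  revert w; decide +kernel

theorem sum_evenChar {M : Type*} [AddCommMonoid M] (f : EvenChar → M) :
    ∑ m, f m = f char00 + ∑ i, ∑ j, f (matA i j) := by
  have hb : Function.Bijective
      (fun o : Option (Fin 3 × Fin 3) => o.elim char00 fun p => matA p.1 p.2) := by
    decide +kernel
  rw [← Fintype.sum_bijective _ hb (fun o => f (o.elim char00 fun p => matA p.1 p.2)) f
    fun _ => rfl, Fintype.sum_option, Fintype.sum_prod_type]
  rfl

theorem sum_typeI_mul (σ : Equiv.Perm (Fin 3)) (f : EvenChar → ℂ) :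
    ∑ m, typeI σ m * f m = f char00 - ∑ i, f (matA i (σ i)) := by
  simp [typeI, Fin.sum_univ_three, Pi.single_apply, sub_mul, add_mul, Finset.sum_add_distrib]

theorem sum_typeII_mul (i k j l : Fin 3) (f : EvenChar → ℂ) :
    ∑ m, typeII i k j l m * f m =
      f (matA i j) + f (matA k l) - (f (matA i l) + f (matA k j)) := by
  simp [typeII, Pi.single_apply, sub_mul, add_mul, Finset.sum_add_distrib]

theorem orbitSum_charWeight_char00_values :
    orbitSum (charWeight char00.1) ((0, 0), (0, 0)) = 6 ∧
    orbitSum (charWeight char00.1) ((1, 0), (0, 0)) = 2 ∧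
    orbitSum (charWeight char00.1) ((0, 0), (1, 0)) = 2 ∧
    orbitSum (charWeight char00.1) ((1, 0), (1, 0)) = 2 ∧
    orbitSum (charWeight char00.1) ((1, 0), (0, 1)) = 0 := by
  decide +kernel

theorem orbitSum_charWeight_matA_values :
    (∀ p : Fin 3 × Fin 3, orbitSum (charWeight (matA p.1 p.2).1) ((0, 0), (0, 0)) =
      !![0, 0, 0; 6, 6, 6; 0, 0, 0] p.1 p.2) ∧
    (∀ p : Fin 3 × Fin 3, orbitSum (charWeight (matA p.1 p.2).1) ((1, 0), (0, 0)) =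
      !![0, 0, 4; -2, -2, 2; 0, 0, 4] p.1 p.2) ∧
    (∀ p : Fin 3 × Fin 3, orbitSum (charWeight (matA p.1 p.2).1) ((0, 0), (1, 0)) =
      !![0, 4, 0; -2, 2, -2; 0, 4, 0] p.1 p.2) ∧
    (∀ p : Fin 3 × Fin 3, orbitSum (charWeight (matA p.1 p.2).1) ((1, 0), (1, 0)) =
      !![4, 0, 0; 2, -2, -2; 4, 0, 0] p.1 p.2) ∧
    (∀ p : Fin 3 × Fin 3, orbitSum (charWeight (matA p.1 p.2).1) ((1, 0), (0, 1)) =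
      !![2, 2, 2; 0, 0, 0; -2, -2, -2] p.1 p.2) := by
  decide +kernel

theorem eq_char00_or_matA (m : EvenChar) : m = char00 ∨ ∃ i j : Fin 3, m = matA i j := by
  have h : ∀ m : EvenChar, m = char00 ∨ ∃ p : Fin 3 × Fin 3, m = matA p.1 p.2 := by decide +kernel
  exact (h m).imp_right fun ⟨p, hp⟩ => ⟨p.1, p.2, hp⟩

theorem matA_ne_char00 (i j : Fin 3) : matA i j ≠ char00 := by
  have h : ∀ p : Fin 3 × Fin 3, matA p.1 p.2 ≠ char00 := by decide +kernel
  exact h (i, j)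

theorem matA_inj (i j k l : Fin 3) : matA i j = matA k l ↔ i = k ∧ j = l := by
  have h : ∀ p q : Fin 3 × Fin 3, matA p.1 p.2 = matA q.1 q.2 ↔ p.1 = q.1 ∧ p.2 = q.2 := by
    decide +kernel
  exact h (i, j) (k, l)

/-- Completeness on the level of weights: if the orbit sums of the combined weight vanish, then the
coefficients are a combination of those of types I and II. -/
theorem mem_span_of_forall_orbitSum (c : EvenChar → ℂ)
    (hc : ∀ w, ∑ m, c m * ((orbitSum (charWeight m.1) w : ℤ) : ℂ) = 0) :
    c ∈ Submodule.span ℂ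
        (Set.range typeI ∪
          {v | ∃ i k j l : Fin 3, i ≠ k ∧ j ≠ l ∧ v = typeII i k j l}) := by
  set S := Set.range typeI ∪ {v | ∃ i k j l : Fin 3, i ≠ k ∧ j ≠ l ∧ v = typeII i k j l}
  have e0 := hc ((0, 0), (0, 0))
  have e1 := hc ((1, 0), (0, 0))
  have e2 := hc ((0, 0), (1, 0))
  have e3 := hc ((1, 0), (1, 0))
  have e4 := hc ((1, 0), (0, 1))
  obtain ⟨u0, u1, u2, u3, u4⟩ := orbitSum_charWeight_char00_values
  obtain ⟨v0, v1, v2, v3, v4⟩ := orbitSum_charWeight_matA_values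
  rw [sum_evenChar] at e0 e1 e2 e3 e4
  simp [Fin.sum_univ_three, fun i j => v0 (i, j), u0] at e0
  simp [Fin.sum_univ_three, fun i j => v1 (i, j), u1] at e1
  simp [Fin.sum_univ_three, fun i j => v2 (i, j), u2] at e2
  simp [Fin.sum_univ_three, fun i j => v3 (i, j), u3] at e3
  simp [Fin.sum_univ_three, fun i j => v4 (i, j), u4] at e4
  -- `e0, …, e4` amount to: every row and every column of `(c (A i j))` has sum `-c 00`.
  -- So `c - c 00 • typeI 1` has zero row and column sums, and is a combination of the
  -- `2 × 2` submatrices that contain the corner `(2, 2)`.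
  have hI : typeI 1 ∈ Submodule.span ℂ S := Submodule.subset_span (Or.inl ⟨1, rfl⟩)
  have hII : ∀ i j : Fin 3, i ≠ 2 → j ≠ 2 → typeII i 2 j 2 ∈ Submodule.span ℂ S :=
    fun i j hi hj => Submodule.subset_span (Or.inr ⟨i, 2, j, 2, hi, hj, rfl⟩)
  have key : c = c char00 • typeI 1
      + ((c (matA 0 0) + c char00) • typeII 0 2 0 2 + c (matA 0 1) • typeII 0 2 1 2
        + (c (matA 1 0) • typeII 1 2 0 2 + (c (matA 1 1) + c char00) • typeII 1 2 1 2)) := by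
    funext m
    rcases eq_char00_or_matA m with rfl | ⟨i, j, rfl⟩
    · simp [typeI, typeII, (matA_ne_char00 _ _).symm]
    · fin_cases i <;> fin_cases j <;>
        simp [typeI, typeII, matA_ne_char00, matA_inj, Fin.sum_univ_three] <;> grind
  rw [key]
  exact add_mem (Submodule.smul_mem _ _ hI) (add_mem
    (add_mem (Submodule.smul_mem _ _ (hII _ _ (by decide) (by decide)))
      (Submodule.smul_mem _ _ (hII _ _ (by decide) (by decide))))
    (add_mem (Submodule.smul_mem _ _ (hII _ _ (by decide) (by decide)))
      (Submodule.smul_mem _ _ (hII _ _ (by decide) (by decide)))))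

/-! ### The theta products as lattice sums -/

/-- The quadratic form `(a, b) τ (a, b)ᵗ` of a complex `2 × 2` matrix `τ`. -/
def quadForm (τ : Matrix (Fin 2) (Fin 2) ℂ) (a b : ℂ) : ℂ :=
  τ 0 0 * a ^ 2 + (τ 0 1 + τ 1 0) * (a * b) + τ 1 1 * b ^ 2

theorem exists_pos_le_im_quadForm {τ : Matrix (Fin 2) (Fin 2) ℂ} (hτ : τ ∈ SiegelHalfSpace 2) :
    ∃ c : ℝ, 0 < c ∧ ∀ a b : ℝ, c * (a ^ 2 + b ^ 2) ≤ (quadForm τ a b).im := by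
  obtain ⟨hs, hp⟩ := hτ
  have h00 : 0 < (τ 0 0).im := hp.diag_pos (i := 0)
  have h11 : 0 < (τ 1 1).im := hp.diag_pos (i := 1)
  have hdet := hp.det_pos
  have h10 : τ 1 0 = τ 0 1 := hs.apply 0 1
  rw [Matrix.det_fin_two] at hdet
  simp only [Matrix.map_apply, h10] at hdet
  have htr : 0 < (τ 0 0).im + (τ 1 1).im := by positivity
  refine ⟨((τ 0 0).im * (τ 1 1).im - (τ 0 1).im * (τ 0 1).im) / ((τ 0 0).im + (τ 1 1).im),
    div_pos hdet htr, fun a b => ?_⟩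
  have him : (quadForm τ a b).im =
      (τ 0 0).im * a ^ 2 + 2 * (τ 0 1).im * (a * b) + (τ 1 1).im * b ^ 2 := by
    simp only [quadForm, h10, pow_two, Complex.add_im, Complex.add_re, Complex.mul_im,
      Complex.mul_re, Complex.ofReal_re, Complex.ofReal_im]
    ring
  rw [him, div_mul_eq_mul_div, div_le_iff₀ htr]
  -- Cayley–Hamilton: `tr Y · Y - det Y = Y²` is positive semidefinite
  nlinarith [sq_nonneg ((τ 0 0).im * a + (τ 0 1).im * b),
    sq_nonneg ((τ 0 1).im * a + (τ 1 1).im * b)]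

theorem summable_exp_neg_mul_int_sq {c : ℝ} (hc : 0 < c) :
    Summable fun n : ℤ => Real.exp (-c * (n : ℝ) ^ 2) := by
  refine (summable_pow_mul_jacobiTheta₂_term_bound 0 (div_pos hc Real.pi_pos) 0).congr fun n => ?_
  have := Real.pi_ne_zero
  rw [pow_zero, one_mul]
  congr 1
  field_simp
  ring

theorem summable_exp_neg_mul_int_sq_prod {c : ℝ} (hc : 0 < c) :
    Summable fun u : ℤ × ℤ => Real.exp (-c * ((u.1 : ℝ) ^ 2 + (u.2 : ℝ) ^ 2)) := by
  refine ((summable_exp_neg_mul_int_sq hc).mul_of_nonneg (summable_exp_neg_mul_int_sq hc)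
    (fun _ => (Real.exp_pos _).le) (fun _ => (Real.exp_pos _).le)).congr fun u => ?_
  rw [← Real.exp_add]
  ring_nf

/-- The term `exp (πi ∑ τ_jk Re (v_j v̄_k))` of the theta series of the lattice `ℤ[ω]²`. The mixed
coefficient `Re (v₁ v̄₂)` is written through norms as `(|v₁|² + |v₂|² - |v₁ - v₂|²) / 2`. -/
noncomputable def latticeTerm (τ : Matrix (Fin 2) (Fin 2) ℂ) (v : EisPair ℤ) : ℂ :=
  Complex.exp (Real.pi * Complex.I *
    (τ 0 0 * (eisNorm v.1 : ℤ) + τ 1 1 * (eisNorm v.2 : ℤ)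
      + (τ 0 1 + τ 1 0) / 2 * (eisNorm v.1 + eisNorm v.2 - eisNorm (v.1 - v.2) : ℤ)))

/-- The term at `v = x + y ω = a + b √-3`, with `a = x - y / 2` and `b = y / 2`. -/
theorem latticeTerm_eq (τ : Matrix (Fin 2) (Fin 2) ℂ) (v : EisPair ℤ) :
    latticeTerm τ v = Complex.exp (Real.pi * Complex.I *
      (quadForm τ ((v.1.1 - v.1.2 / 2 : ℝ) : ℂ) ((v.2.1 - v.2.2 / 2 : ℝ) : ℂ)
        + 3 * quadForm τ ((v.1.2 / 2 : ℝ) : ℂ) ((v.2.2 / 2 : ℝ) : ℂ))) := by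
  rw [latticeTerm]
  congr 2
  simp only [eisNorm, quadForm, Prod.fst_sub, Prod.snd_sub]
  push_cast
  ring

theorem summable_norm_latticeTerm {τ : Matrix (Fin 2) (Fin 2) ℂ} (hτ : τ ∈ SiegelHalfSpace 2) :
    Summable fun v => ‖latticeTerm τ v‖ := by
  obtain ⟨c, hc, h⟩ := exists_pos_le_im_quadForm hτ
  have hc' : 0 < Real.pi * c / 2 := by positivity
  refine Summable.of_nonneg_of_le (fun _ => norm_nonneg _) (fun v => ?_)
    ((summable_exp_neg_mul_int_sq_prod hc').mul_of_nonneg (summable_exp_neg_mul_int_sq_prod hc')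
      (fun _ => (Real.exp_pos _).le) (fun _ => (Real.exp_pos _).le))
  rw [latticeTerm_eq, Complex.norm_exp, ← Real.exp_add, Real.exp_le_exp]
  have h1 := h (v.1.1 - v.1.2 / 2) (v.2.1 - v.2.2 / 2)
  have h2 := h (v.1.2 / 2) (v.2.2 / 2)
  have hre : ∀ z : ℂ, (Real.pi * Complex.I * z).re = -(Real.pi * z.im) := fun z => by simp
  have h3 : ∀ z : ℂ, (3 * z).im = 3 * z.im := fun z => by simp
  rw [hre, Complex.add_im, h3]
  have hx : ∀ x y : ℝ, (x ^ 2 + y ^ 2) / 2 ≤ (x - y / 2) ^ 2 + 3 * (y / 2) ^ 2 := fun x y => by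
    nlinarith [sq_nonneg (x - y)]
  have h4 := mul_le_mul_of_nonneg_left
    (add_le_add (hx v.1.1 v.1.2) (hx v.2.1 v.2.2)) hc.le
  have h5 := mul_le_mul_of_nonneg_left (a := Real.pi) (h4.trans (by linarith :
    _ ≤ (quadForm τ ↑((v.1.1 : ℝ) - v.1.2 / 2) ↑((v.2.1 : ℝ) - v.2.2 / 2)).im
      + 3 * (quadForm τ ↑((v.1.2 : ℝ) / 2) ↑((v.2.2 : ℝ) / 2)).im)) Real.pi_pos.le
  linarith

theorem thetaTerm_zero_eq (ε ε' : Fin 2 → ℤ) (τ : Matrix (Fin 2) (Fin 2) ℂ) (l : Fin 2 → ℤ) :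
    thetaTerm (fun k => (ε k : ℝ)) (fun k => (ε' k : ℝ)) 0 τ l =
      Complex.exp (Real.pi * Complex.I *
        (quadForm τ ((l 0 + ε 0 / 2 : ℝ) : ℂ) ((l 1 + ε 1 / 2 : ℝ) : ℂ)
          + (((l 0 + ε 0 / 2) * ε' 0 + (l 1 + ε 1 / 2) * ε' 1 : ℝ) : ℂ))) := by
  rw [thetaTerm]
  congr 1
  simp only [quadForm, Fin.sum_univ_two, Pi.zero_apply]
  push_cast
  ring

theorem summable_norm_thetaTerm {τ : Matrix (Fin 2) (Fin 2) ℂ} {c : ℝ} (hc : 0 < c)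
    (h : ∀ a b : ℝ, c * (a ^ 2 + b ^ 2) ≤ (quadForm τ a b).im) (ε ε' : Fin 2 → ℤ) :
    Summable fun l => ‖thetaTerm (fun k => (ε k : ℝ)) (fun k => (ε' k : ℝ)) 0 τ l‖ := by
  have hc' : 0 < Real.pi * c / 4 := by positivity
  have hinj : Function.Injective
      (fun l : Fin 2 → ℤ => ((2 * l 0 + ε 0, 2 * l 1 + ε 1) : ℤ × ℤ)) := by
    intro l l' hl
    simp only [Prod.mk.injEq] at hl
    ext i
    fin_cases i
    · simp; lia
    · simp; lia
  refine Summable.of_nonneg_of_le (fun _ => norm_nonneg _) (fun l => ?_)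
    ((summable_exp_neg_mul_int_sq_prod hc').comp_injective hinj)
  rw [thetaTerm_zero_eq, Complex.norm_exp, Function.comp_apply, Real.exp_le_exp]
  have h1 := mul_le_mul_of_nonneg_left (h (l 0 + ε 0 / 2) (l 1 + ε 1 / 2)) Real.pi_pos.le
  have hre : ∀ z : ℂ, (Real.pi * Complex.I * z).re = -(Real.pi * z.im) := fun z => by simp
  rw [hre, Complex.add_im, Complex.ofReal_im]
  push_cast at h1 ⊢
  linarith

/-- Reduction modulo `2`, from `ℤ[ω]²` to `𝔽₄²`. -/
def modTwo (v : EisPair ℤ) : EisPair (ZMod 2) :=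
  ((v.1.1, v.1.2), (v.2.1, v.2.2))

/-- The theta series of `ℤ[ω]²` in which the term at `v` has the weight `φ (v mod 2)`. -/
noncomputable def latticeSum (φ : EisPair (ZMod 2) → ℂ)
    (τ : Matrix (Fin 2) (Fin 2) ℂ) : ℂ :=
  ∑' v, φ (modTwo v) * latticeTerm τ v

theorem summable_latticeSum (φ : EisPair (ZMod 2) → ℂ)
    {τ : Matrix (Fin 2) (Fin 2) ℂ} (hτ : τ ∈ SiegelHalfSpace 2) :
    Summable fun v => φ (modTwo v) * latticeTerm τ v := by
  refine Summable.of_norm_bounded ((summable_norm_latticeTerm hτ).mul_left (∑ w, ‖φ w‖))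
    fun v => ?_
  rw [norm_mul]
  exact mul_le_mul_of_nonneg_right (Finset.single_le_sum (f := fun w => ‖φ w‖)
    (fun _ _ => norm_nonneg _) (Finset.mem_univ _)) (norm_nonneg _)

theorem exp_pi_mul_I_int (n : ℤ) :
    Complex.exp (Real.pi * Complex.I * n) = if (n : ZMod 2) = 0 then 1 else -1 := by
  rcases Int.even_or_odd n with h | h
  · rw [if_pos ((ZMod.intCast_zmod_eq_zero_iff_dvd n 2).2 (even_iff_two_dvd.1 h))]
    obtain ⟨k, rfl⟩ := h
    rw [Complex.exp_eq_one_iff]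
    exact ⟨k, by push_cast; ring⟩
  · rw [if_neg (fun h0 => by
      rw [← Int.not_even_iff_odd] at h
      exact h (even_iff_two_dvd.2 ((ZMod.intCast_zmod_eq_zero_iff_dvd n 2).1 h0)))]
    obtain ⟨k, rfl⟩ := h
    rw [show (Real.pi * Complex.I * ((2 * k + 1 : ℤ) : ℂ) : ℂ) =
      Real.pi * Complex.I + k * (2 * Real.pi * Complex.I) by push_cast; ring,
      Complex.exp_periodic.int_mul k, Complex.exp_pi_mul_I]

/-- The products of theta constants are weighted theta series of `ℤ[ω]²`. -/
theorem thetaConst_mul_thetaConst_eq_latticeSum (i j : Fin 4) {τ : Matrix (Fin 2) (Fin 2) ℂ}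
    (hτ : τ ∈ SiegelHalfSpace 2) :
    thetaConst i j τ * thetaConst i j ((3 : ℂ) • τ) =
      latticeSum (fun w => (charWeight (i, j) w : ℂ)) τ := by
  obtain ⟨c, hc, h⟩ := exists_pos_le_im_quadForm hτ
  have hq : ∀ a b, quadForm ((3 : ℂ) • τ) a b = 3 * quadForm τ a b := fun a b => by
    simp only [quadForm, Matrix.smul_apply, smul_eq_mul]
    ring
  have h' : ∀ a b : ℝ, (3 * c) * (a ^ 2 + b ^ 2) ≤ (quadForm ((3 : ℂ) • τ) a b).im := fun a b => by
    rw [hq]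
    have := h a b
    simp only [Complex.mul_im, Complex.re_ofNat, Complex.im_ofNat]
    linarith
  rw [thetaConst, thetaConst, theta, theta, tsum_mul_tsum_of_summable_norm
    (summable_norm_thetaTerm hc h _ _) (summable_norm_thetaTerm (by positivity) h' _ _)]
  set ε := upperRow i j
  set ε' := lowerRow i j
  have hε0 : colUpper i = ε 0 := rfl
  have hε1 : colUpper j = ε 1 := rfl
  have hε'0 : colLower i = ε' 0 := rfl
  have hε'1 : colLower j = ε' 1 := rfl
  -- For `a = l + ε / 2` and `b = k + ε / 2` this is `(l, k) ↦ x + y ω`, `x = a + b`, `y = 2 b`.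
  let e : (Fin 2 → ℤ) × (Fin 2 → ℤ) → EisPair ℤ := fun p =>
    ((p.1 0 + p.2 0 + ε 0, 2 * p.2 0 + ε 0), (p.1 1 + p.2 1 + ε 1, 2 * p.2 1 + ε 1))
  have he : Function.Injective e := by
    rintro ⟨l, k⟩ ⟨l', k'⟩ hlk
    simp only [e, Prod.mk.injEq] at hlk
    ext t <;> fin_cases t <;> simp <;> lia
  have hsupp : (Function.support fun v : EisPair ℤ =>
      (charWeight (i, j) (modTwo v) : ℂ) * latticeTerm τ v) ⊆ Set.range e := by
    intro v hv
    have hv' := left_ne_zero_of_mul hv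
    have h1 : ((v.1.2 : ZMod 2) = (colUpper i : ZMod 2)) ∧
        ((v.2.2 : ZMod 2) = (colUpper j : ZMod 2)) := by
      by_contra h0
      exact hv' (by simp [charWeight, modTwo, h0])
    rw [hε0, hε1, ZMod.intCast_eq_intCast_iff_dvd_sub, ZMod.intCast_eq_intCast_iff_dvd_sub] at h1
    obtain ⟨⟨s, hs⟩, ⟨t, ht⟩⟩ := h1
    push_cast at hs ht
    refine ⟨(![v.1.1 + s - ε 0, v.2.1 + t - ε 1], ![-s, -t]), ?_⟩
    ext <;> simp [e] <;> lia
  rw [latticeSum, ← he.tsum_eq hsupp]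
  refine tsum_congr fun p => ?_
  have hw : (charWeight (i, j) (modTwo (e p)) : ℂ) = Complex.exp (Real.pi * Complex.I *
      ((ε' 0 * (p.1 0 + p.2 0 + ε 0) + ε' 1 * (p.1 1 + p.2 1 + ε 1) : ℤ) : ℂ)) := by
    have h2 : (2 : ZMod 2) = 0 := rfl
    rw [exp_pi_mul_I_int]
    simp [charWeight, modTwo, e, hε0, hε1, hε'0, hε'1, h2]
  rw [hw, thetaTerm_zero_eq, thetaTerm_zero_eq, latticeTerm_eq, ← Complex.exp_add,
    ← Complex.exp_add, hq]
  congr 1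
  simp only [e, quadForm]
  push_cast
  ring

/-! ### Symmetries of the lattice sums -/

theorem latticeSum_comp_prodMap (φ : EisPair (ZMod 2) → ℂ)
    (τ : Matrix (Fin 2) (Fin 2) ℂ) (e : ℤ × ℤ ≃ ℤ × ℤ) (g : ZMod 2 × ZMod 2 → ZMod 2 × ZMod 2)
    (hN : ∀ u, eisNorm (e u) = eisNorm u) (hsub : ∀ u v, e u - e v = e (u - v))
    (hg : ∀ v, modTwo (Prod.map e e v) = Prod.map g g (modTwo v)) :
    latticeSum (φ ∘ Prod.map g g) τ = latticeSum φ τ := by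
  rw [latticeSum, latticeSum,
    ← (e.prodCongr e).tsum_eq (fun v => φ (modTwo v) * latticeTerm τ v)]
  refine tsum_congr fun v => ?_
  rw [Function.comp_apply, ← hg]
  simp only [latticeTerm, Equiv.prodCongr_apply, Prod.map_fst, Prod.map_snd, hsub, hN]

theorem latticeSum_comp_eisMul (φ : EisPair (ZMod 2) → ℂ)
    (τ : Matrix (Fin 2) (Fin 2) ℂ) :
    latticeSum (φ ∘ Prod.map eisMul eisMul) τ = latticeSum φ τ :=
  latticeSum_comp_prodMap φ τ
    ⟨eisMul, fun u => eisMul (eisMul u),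
      fun u => Prod.ext (by simp [eisMul]) (by simp [eisMul]; ring),
      fun u => Prod.ext (by simp [eisMul]) (by simp [eisMul]; ring)⟩ eisMul
    (fun u => by simp only [Equiv.coe_fn_mk, eisMul, eisNorm]; ring)
    (fun u v => by ext <;> simp [eisMul] <;> ring)
    (fun v => by simp [modTwo, eisMul])

theorem latticeSum_comp_eisConj (φ : EisPair (ZMod 2) → ℂ)
    (τ : Matrix (Fin 2) (Fin 2) ℂ) :
    latticeSum (φ ∘ Prod.map eisConj eisConj) τ = latticeSum φ τ :=
  latticeSum_comp_prodMap φ τ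
    ⟨eisConj, eisConj, fun u => by simp [eisConj], fun u => by simp [eisConj]⟩ eisConj
    (fun u => by simp only [Equiv.coe_fn_mk, eisConj, eisNorm]; ring)
    (fun u v => by ext <;> simp [eisConj] <;> ring)
    (fun v => by simp [modTwo, eisConj])

theorem latticeSum_add (φ ψ : EisPair (ZMod 2) → ℂ)
    {τ : Matrix (Fin 2) (Fin 2) ℂ} (hτ : τ ∈ SiegelHalfSpace 2) :
    latticeSum (φ + ψ) τ = latticeSum φ τ + latticeSum ψ τ := by
  rw [latticeSum, latticeSum, latticeSum,
    ← (summable_latticeSum φ hτ).tsum_add (summable_latticeSum ψ hτ)]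
  exact tsum_congr fun v => add_mul _ _ _

theorem latticeSum_smul (a : ℂ) (φ : EisPair (ZMod 2) → ℂ)
    (τ : Matrix (Fin 2) (Fin 2) ℂ) : latticeSum (a • φ) τ = a * latticeSum φ τ := by
  rw [latticeSum, latticeSum, ← tsum_mul_left]
  exact tsum_congr fun v => mul_assoc _ _ _

theorem latticeSum_orbitSum (φ : EisPair (ZMod 2) → ℂ)
    {τ : Matrix (Fin 2) (Fin 2) ℂ} (hτ : τ ∈ SiegelHalfSpace 2) :
    latticeSum (orbitSum φ) τ = 6 * latticeSum φ τ := by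
  set ρ : EisPair (ZMod 2) → EisPair (ZMod 2) :=
    Prod.map eisMul eisMul with hρ
  set κ : EisPair (ZMod 2) → EisPair (ZMod 2) :=
    Prod.map eisConj eisConj with hκ
  have h : orbitSum φ = φ + φ ∘ ρ + (φ ∘ ρ) ∘ ρ + (φ ∘ κ + (φ ∘ κ) ∘ ρ + ((φ ∘ κ) ∘ ρ) ∘ ρ) := rfl
  rw [h]
  simp only [latticeSum_add _ _ hτ, hρ, hκ, latticeSum_comp_eisMul, latticeSum_comp_eisConj]
  ring

/-- A combination of theta products is, up to the factor `6`, the series of the orbit sums of the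
combined weight. -/
theorem six_mul_sum_thetaProd (c : EvenChar → ℂ) {τ : Matrix (Fin 2) (Fin 2) ℂ}
    (hτ : τ ∈ SiegelHalfSpace 2) :
    6 * ∑ m, c m * thetaProd m τ =
      latticeSum (fun w => ∑ m, c m * ((orbitSum (charWeight m.1) w : ℤ) : ℂ)) τ := by
  have hlin : ∀ s : Finset EvenChar,
      latticeSum (fun w => ∑ m ∈ s, c m * ((orbitSum (charWeight m.1) w : ℤ) : ℂ)) τ =
        6 * ∑ m ∈ s, c m * thetaProd m τ := by
    intro s
    induction s using Finset.induction_on with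
    | empty => simp [latticeSum]
    | insert m s hm ih =>
      have h1 : (fun w => ∑ m ∈ insert m s, c m * ((orbitSum (charWeight m.1) w : ℤ) : ℂ)) =
          c m • orbitSum (fun w => (charWeight m.1 w : ℂ))
            + fun w => ∑ m ∈ s, c m * ((orbitSum (charWeight m.1) w : ℤ) : ℂ) := by
        funext w
        simp [Finset.sum_insert hm, orbitSum]
      rw [h1, latticeSum_add _ _ hτ, latticeSum_smul, latticeSum_orbitSum _ hτ, ih,
        Finset.sum_insert hm, thetaProd, thetaConst_mul_thetaConst_eq_latticeSum _ _ hτ]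
      ring
  exact (hlin Finset.univ).symm

theorem isThetaRelation_of_forall_orbitSum {c : EvenChar → ℂ}
    (hc : ∀ w, ∑ m, c m * ((orbitSum (charWeight m.1) w : ℤ) : ℂ) = 0) : IsThetaRelation c := by
  intro τ hτ
  have h := six_mul_sum_thetaProd c hτ
  simp only [hc] at h
  simpa [latticeSum] using h

/-! ### Linear independence of the orbit series -/

/-- The form `α |v₁|² + β |v₂|² + γ |v₁ - v₂|²` on `ℤ[ω]²`. -/
def normForm (α β γ : ℕ) (v : EisPair ℤ) : ℤ :=
  α * eisNorm v.1 + β * eisNorm v.2 + γ * eisNorm (v.1 - v.2)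

/-- The matrix `i t Y`, for the real symmetric `Y` such that the term of the theta series at `v` is
`exp (-π t · normForm α β γ v)`. -/
noncomputable def rayPoint (α β γ : ℕ) (t : ℝ) : Matrix (Fin 2) (Fin 2) ℂ :=
  (t * Complex.I) • !![(α + γ : ℂ), -γ; -γ, β + γ]

theorem rayPoint_mem {α β γ : ℕ} (hα : 0 < α) (hβγ : 0 < β + γ) {t : ℝ} (ht : 0 < t) :
    rayPoint α β γ t ∈ SiegelHalfSpace 2 := by
  have hsymm : (rayPoint α β γ t).IsSymm := by
    ext i j
    fin_cases i <;> fin_cases j <;> simp [rayPoint]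
  refine ⟨hsymm, Matrix.PosDef.of_dotProduct_mulVec_pos ?_ fun x hx => ?_⟩
  · ext i j
    simp [hsymm.apply i j]
  · have hα' : (0 : ℝ) < α := by exact_mod_cast hα
    have hβγ' : (0 : ℝ) < β + γ := by exact_mod_cast hβγ
    have hform : star x ⬝ᵥ ((rayPoint α β γ t).map Complex.im).mulVec x =
        t * (α * x 0 ^ 2 + β * x 1 ^ 2 + γ * (x 0 - x 1) ^ 2) := by
      simp [rayPoint, dotProduct, Matrix.mulVec, Fin.sum_univ_two]
      ring
    rw [hform]
    refine mul_pos ht ?_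
    by_cases h0 : x 0 = 0
    · have h1 : x 1 ≠ 0 := fun h1 => hx (by ext i; fin_cases i <;> simp [h0, h1])
      have := mul_pos hβγ' (sq_pos_of_ne_zero h1)
      rw [h0]
      nlinarith
    · have := mul_pos hα' (sq_pos_of_ne_zero h0)
      have h2 : 0 ≤ (β : ℝ) * x 1 ^ 2 := by positivity
      have h3 : 0 ≤ (γ : ℝ) * (x 0 - x 1) ^ 2 := by positivity
      linarith

theorem latticeTerm_rayPoint (α β γ : ℕ) (t : ℝ) (v : EisPair ℤ) :
    latticeTerm (rayPoint α β γ t) v = Real.exp (-(Real.pi * t * normForm α β γ v)) := by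
  rw [latticeTerm, Complex.ofReal_exp]
  congr 1
  simp [rayPoint, normForm]
  linear_combination (Real.pi * t * (α * ((eisNorm v.1 : ℤ) : ℂ) + β * ((eisNorm v.2 : ℤ) : ℂ)
    + γ * ((eisNorm (v.1 - v.2) : ℤ) : ℂ))) * Complex.I_mul_I

/-- If a weighted theta series vanishes identically, and the weight is zero where
`normForm α β γ < d` and is `C` where `normForm α β γ = d`, then `C = 0`: after division by
`exp (-π t d)`, the series on the ray `t ↦ rayPoint α β γ t` tends to `C` times the number
of vectors with `normForm α β γ = d`. -/
theorem eq_zero_of_latticeSum_eq_zero {φ : EisPair (ZMod 2) → ℂ}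
    (hφ : ∀ τ ∈ SiegelHalfSpace 2, latticeSum φ τ = 0) {α β γ : ℕ} (hα : 0 < α)
    (hβγ : 0 < β + γ) (d : ℤ) (C : ℂ) (hlt : ∀ v, normForm α β γ v < d → φ (modTwo v) = 0)
    (heq : ∀ v, normForm α β γ v = d → φ (modTwo v) = C) (hex : ∃ v, normForm α β γ v = d) :
    C = 0 := by
  -- The terms on the ray at `t = n + 1`, divided by `exp (-π t d)`.
  set f : ℕ → EisPair ℤ → ℂ := fun n v =>
    φ (modTwo v) * (Real.exp (-(Real.pi * (n + 1 : ℕ) * ((normForm α β γ v - d : ℤ) : ℝ))) : ℝ)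
    with hf
  have hfl : ∀ n v, f n v = (Real.exp (Real.pi * (n + 1 : ℕ) * d) : ℂ) *
      (φ (modTwo v) * latticeTerm (rayPoint α β γ (n + 1 : ℕ)) v) := by
    intro n v
    rw [latticeTerm_rayPoint, mul_left_comm, ← Complex.ofReal_mul, ← Real.exp_add]
    simp only [hf]
    congr 3
    push_cast
    ring
  have hmem : ∀ n : ℕ, rayPoint α β γ (n + 1 : ℕ) ∈ SiegelHalfSpace 2 := fun n =>
    rayPoint_mem hα hβγ (by positivity)
  have hsum : ∀ n, ∑' v, f n v = 0 := by
    intro n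
    simp only [hfl]
    rw [tsum_mul_left]
    exact mul_eq_zero_of_right _ (hφ _ (hmem n))
  have hbound : Summable fun v => ‖f 0 v‖ := by
    simp only [hfl]
    exact ((summable_latticeSum φ (hmem 0)).mul_left _).norm
  set g : EisPair ℤ → ℂ := fun v => if normForm α β γ v = d then C else 0 with hg
  have hlim : Filter.Tendsto (fun n => ∑' v, f n v) Filter.atTop (nhds (∑' v, g v)) := by
    refine tendsto_tsum_of_dominated_convergence hbound (fun v => ?_)
      (Filter.Eventually.of_forall fun n v => ?_)
    · rcases lt_trichotomy (normForm α β γ v) d with h | h | h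
      · simp [hf, hg, hlt v h, h.ne]
      · simp [hf, hg, heq v h, h]
      · have hpos : (0 : ℝ) < ((normForm α β γ v - d : ℤ) : ℝ) := by
          exact_mod_cast sub_pos.2 h
        have h1 : Filter.Tendsto (fun n : ℕ => Real.exp
            (-(Real.pi * (n + 1 : ℕ) * ((normForm α β γ v - d : ℤ) : ℝ))))
            Filter.atTop (nhds 0) := by
          refine Real.tendsto_exp_neg_atTop_nhds_zero.comp ?_
          refine Filter.Tendsto.atTop_mul_const hpos ?_
          refine Filter.Tendsto.const_mul_atTop Real.pi_pos ?_
          exact tendsto_natCast_atTop_atTop.comp (Filter.tendsto_add_atTop_nat 1)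
        have h2 := ((Complex.continuous_ofReal.tendsto _).comp h1).const_mul (φ (modTwo v))
        simpa [hf, hg, h.ne'] using h2
    · rcases lt_or_ge (normForm α β γ v) d with h | h
      · simp [hf, hlt v h]
      · simp only [hf, norm_mul, Complex.norm_real, Real.norm_eq_abs, Real.abs_exp]
        refine mul_le_mul_of_nonneg_left (Real.exp_le_exp.2 (neg_le_neg ?_)) (norm_nonneg _)
        have hnn : (0 : ℝ) ≤ ((normForm α β γ v - d : ℤ) : ℝ) := by
          exact_mod_cast sub_nonneg.2 h
        have hn : ((0 + 1 : ℕ) : ℝ) ≤ ((n + 1 : ℕ) : ℝ) := by exact_mod_cast (by lia)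
        gcongr
  simp only [hsum] at hlim
  have hg0 : ∑' v, g v = 0 := tendsto_nhds_unique hlim tendsto_const_nhds
  by_contra hC
  have hgs : Summable g := by
    refine Summable.of_norm_bounded hbound fun v => ?_
    by_cases h : normForm α β γ v = d
    · simp [hf, hg, heq v h, h]
    · simp [hg, h]
  obtain ⟨v₀, hv₀⟩ := hex
  set a : EisPair ℤ → ℝ := fun v => if normForm α β γ v = d then 1 else 0 with ha
  have hga : g = fun v => C * (a v : ℂ) := by
    funext v
    by_cases h : normForm α β γ v = d <;> simp [hg, ha, h]
  have has : Summable a := by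
    rw [hga] at hgs
    exact Complex.summable_ofReal.1 ((summable_mul_left_iff hC).1 hgs)
  have hpos : 0 < ∑' v, a v :=
    has.tsum_pos (fun v => by simp only [ha]; split_ifs <;> norm_num) v₀ (by simp [ha, hv₀])
  rw [hga, tsum_mul_left, ← Complex.ofReal_tsum] at hg0
  exact (mul_ne_zero hC (by exact_mod_cast hpos.ne')) hg0

theorem eisNorm_nonneg (u : ℤ × ℤ) : 0 ≤ eisNorm u := by
  rw [eisNorm]
  nlinarith [sq_nonneg (u.1 - u.2), sq_nonneg u.1, sq_nonneg u.2]

theorem eisNorm_eq_zero {u : ℤ × ℤ} (h : eisNorm u = 0) : u = 0 := by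
  rw [eisNorm] at h
  have h1 : u.1 = 0 := by
    nlinarith [sq_nonneg (u.1 - 2 * u.2), sq_nonneg u.1]
  have h2 : u.2 = 0 := by
    nlinarith [sq_nonneg (u.2 - 2 * u.1), sq_nonneg u.2]
  exact Prod.ext h1 h2

theorem eisNorm_modTwo_fst (v : EisPair ℤ) :
    eisNorm (modTwo v).1 = (eisNorm v.1 : ℤ) := by
  simp [eisNorm, modTwo]

theorem eisNorm_modTwo_snd (v : EisPair ℤ) :
    eisNorm (modTwo v).2 = (eisNorm v.2 : ℤ) := by
  simp [eisNorm, modTwo]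

theorem eisNorm_modTwo_sub (v : EisPair ℤ) :
    eisNorm ((modTwo v).1 - (modTwo v).2) = (eisNorm (v.1 - v.2) : ℤ) := by
  simp [eisNorm, modTwo]

/-- In a relation, the orbit sums of the combined weight vanish. The orbits are treated in turn by
forms whose least vectors, among those not yet known to have weight zero, lie in a single orbit. -/
theorem forall_orbitSum_of_isThetaRelation {c : EvenChar → ℂ} (hc : IsThetaRelation c)
    (w : EisPair (ZMod 2)) :
    ∑ m, c m * ((orbitSum (charWeight m.1) w : ℤ) : ℂ) = 0 := by
  set F : EisPair (ZMod 2) → ℂ :=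
    fun w => ∑ m, c m * ((orbitSum (charWeight m.1) w : ℤ) : ℂ) with hF
  have hsum : ∀ τ ∈ SiegelHalfSpace 2, latticeSum F τ = 0 := fun τ hτ => by
    rw [← six_mul_sum_thetaProd c hτ, hc τ hτ, mul_zero]
  have hleft : ∀ w, eisNorm w.1 = 1 → w.2 = 0 → F w = F ((1, 0), (0, 0)) := fun w h1 h2 =>
    Finset.sum_congr rfl fun m _ => by rw [orbitSum_charWeight_left m w h1 h2]
  have hright : ∀ w, eisNorm w.2 = 1 → w.1 = 0 → F w = F ((0, 0), (1, 0)) := fun w h1 h2 =>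
    Finset.sum_congr rfl fun m _ => by rw [orbitSum_charWeight_right m w h1 h2]
  have hdiag : ∀ w, eisNorm w.1 = 1 → w.1 = w.2 → F w = F ((1, 0), (1, 0)) := fun w h1 h2 =>
    Finset.sum_congr rfl fun m _ => by rw [orbitSum_charWeight_diag m w h1 h2]
  have hgen : ∀ w, eisNorm w.1 + eisNorm w.2 + eisNorm (w.1 - w.2) = 1 →
      F w = F ((1, 0), (0, 1)) := fun w h =>
    Finset.sum_congr rfl fun m _ => by rw [orbitSum_charWeight_generic m w h]
  have hnn : ∀ v : EisPair ℤ, 0 ≤ eisNorm v.1 ∧ 0 ≤ eisNorm v.2 ∧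
      0 ≤ eisNorm (v.1 - v.2) := fun v =>
    ⟨eisNorm_nonneg _, eisNorm_nonneg _, eisNorm_nonneg _⟩
  have hzero : ∀ v : EisPair ℤ, eisNorm v.1 = 0 → eisNorm v.2 = 0 → v = 0 :=
    fun v h1 h2 => Prod.ext (eisNorm_eq_zero h1) (eisNorm_eq_zero h2)
  have F0 : F 0 = 0 := by
    refine eq_zero_of_latticeSum_eq_zero hsum (α := 1) (β := 1) (γ := 0) (by simp) (by simp) 0 _
      (fun v hv => ?_) (fun v hv => ?_) ⟨0, by simp [normForm, eisNorm]⟩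
    · obtain ⟨h1, h2, h3⟩ := hnn v
      simp only [normForm] at hv
      lia
    · obtain ⟨h1, h2, h3⟩ := hnn v
      simp only [normForm] at hv
      rw [hzero v (by lia) (by lia)]
      simp [modTwo]
      rfl
  have F1 : F ((1, 0), (0, 0)) = 0 := by
    refine eq_zero_of_latticeSum_eq_zero hsum (α := 1) (β := 2) (γ := 0) (by simp) (by simp) 1 _
      (fun v hv => ?_) (fun v hv => ?_) ⟨((1, 0), (0, 0)), by simp [normForm, eisNorm]⟩
    · obtain ⟨h1, h2, h3⟩ := hnn v
      simp only [normForm] at hv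
      rw [hzero v (by lia) (by lia)]
      exact F0
    · obtain ⟨h1, h2, h3⟩ := hnn v
      simp only [normForm] at hv
      have h4 : v.2 = 0 := eisNorm_eq_zero (by lia)
      refine hleft _ ?_ ?_
      · rw [eisNorm_modTwo_fst, show eisNorm v.1 = 1 by lia, Int.cast_one]
      · simp [modTwo, h4]
  have F2 : F ((0, 0), (1, 0)) = 0 := by
    refine eq_zero_of_latticeSum_eq_zero hsum (α := 2) (β := 1) (γ := 0) (by simp) (by simp) 1 _
      (fun v hv => ?_) (fun v hv => ?_) ⟨((0, 0), (1, 0)), by simp [normForm, eisNorm]⟩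
    · obtain ⟨h1, h2, h3⟩ := hnn v
      simp only [normForm] at hv
      rw [hzero v (by lia) (by lia)]
      exact F0
    · obtain ⟨h1, h2, h3⟩ := hnn v
      simp only [normForm] at hv
      have h4 : v.1 = 0 := eisNorm_eq_zero (by lia)
      refine hright _ ?_ ?_
      · rw [eisNorm_modTwo_snd, show eisNorm v.2 = 1 by lia, Int.cast_one]
      · simp [modTwo, h4]
  have F3 : F ((1, 0), (1, 0)) = 0 := by
    refine eq_zero_of_latticeSum_eq_zero hsum (α := 1) (β := 0) (γ := 2) (by simp) (by simp) 1 _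
      (fun v hv => ?_) (fun v hv => ?_) ⟨((1, 0), (1, 0)), by simp [normForm, eisNorm]⟩
    · obtain ⟨h1, h2, h3⟩ := hnn v
      simp only [normForm] at hv
      have h4 : v.1 = v.2 := sub_eq_zero.1 (eisNorm_eq_zero (by lia))
      rw [hzero v (by lia) (by rw [← h4]; lia)]
      exact F0
    · obtain ⟨h1, h2, h3⟩ := hnn v
      simp only [normForm] at hv
      have h4 : v.1 = v.2 := sub_eq_zero.1 (eisNorm_eq_zero (by lia))
      refine hdiag _ ?_ ?_
      · rw [eisNorm_modTwo_fst, show eisNorm v.1 = 1 by lia, Int.cast_one]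
      · simp [modTwo, h4]
  have hcases : ∀ w, F w = 0 ∨ eisNorm w.1 + eisNorm w.2 + eisNorm (w.1 - w.2) = 1 := fun w => by
    rcases eisNorm_cases w with rfl | ⟨h1, h2⟩ | ⟨h1, h2⟩ | ⟨h1, h2⟩ | h
    · exact Or.inl F0
    · exact Or.inl ((hleft w h1 h2).trans F1)
    · exact Or.inl ((hright w h1 h2).trans F2)
    · exact Or.inl ((hdiag w h1 h2).trans F3)
    · exact Or.inr h
  have hmod : ∀ v, eisNorm (modTwo v).1 + eisNorm (modTwo v).2
      + eisNorm ((modTwo v).1 - (modTwo v).2) = (normForm 1 1 1 v : ℤ) := fun v => by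
    rw [eisNorm_modTwo_fst, eisNorm_modTwo_snd, eisNorm_modTwo_sub]
    simp [normForm]
  -- `normForm 1 1 1` is odd exactly on the last orbit, where its least value is `3`.
  have F4 : F ((1, 0), (0, 1)) = 0 := by
    refine eq_zero_of_latticeSum_eq_zero hsum (α := 1) (β := 1) (γ := 1) (by simp) (by simp) 3 _
      (fun v hv => ?_) (fun v hv => ?_) ⟨((1, 0), (1, 1)), by simp [normForm, eisNorm]⟩
    · refine (hcases _).resolve_right fun h => ?_
      rw [hmod] at h
      obtain ⟨h1, h2, h3⟩ := hnn v
      have h4 : normForm 1 1 1 v = 1 := by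
        have h5 : 0 ≤ normForm 1 1 1 v := by simp only [normForm]; lia
        interval_cases normForm 1 1 1 v
        · exact absurd h (by decide)
        · rfl
        · exact absurd h (by decide)
      simp only [normForm] at h4
      -- Two of the three norms vanish, hence all of them do.
      have h6 : v = 0 := by
        rcases (by lia : (eisNorm v.1 = 0 ∧ eisNorm v.2 = 0) ∨
          (eisNorm v.1 = 0 ∧ eisNorm (v.1 - v.2) = 0) ∨
          (eisNorm v.2 = 0 ∧ eisNorm (v.1 - v.2) = 0)) with ⟨ha, hb⟩ | ⟨ha, hb⟩ | ⟨ha, hb⟩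
        · exact hzero v ha hb
        · exact hzero v ha (by rwa [← sub_eq_zero.1 (eisNorm_eq_zero hb)])
        · exact hzero v (by rwa [sub_eq_zero.1 (eisNorm_eq_zero hb)]) ha
      simp [h6, eisNorm] at h4
    · refine hgen _ ?_
      rw [hmod, hv]
      rfl
  rcases hcases w with h | h
  · exact h
  · exact (hgen w h).trans F4

/-! ### The classification -/

theorem thetaProd_matA_add {τ : Matrix (Fin 2) (Fin 2) ℂ} (hτ : τ ∈ SiegelHalfSpace 2)
    (i j : Fin 3) :
    thetaProd (matA i j) τ + thetaProd (matA 0 0) τ =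
      thetaProd (matA i 0) τ + thetaProd (matA 0 j) τ := by
  have h : IsThetaRelation (typeII i 0 j 0) := isThetaRelation_of_forall_orbitSum fun w => by
    rw [sum_typeII_mul i 0 j 0 fun m => ((orbitSum (charWeight m.1) w : ℤ) : ℂ), sub_eq_zero]
    exact_mod_cast orbitSum_charWeight_matA i j w
  have h' := h τ hτ
  rwa [sum_typeII_mul i 0 j 0 fun m => thetaProd m τ, sub_eq_zero] at h'

theorem thetaProd_char00 {τ : Matrix (Fin 2) (Fin 2) ℂ} (hτ : τ ∈ SiegelHalfSpace 2) :
    thetaProd char00 τ = ∑ i, thetaProd (matA i i) τ := by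
  have h : IsThetaRelation (typeI 1) := isThetaRelation_of_forall_orbitSum fun w => by
    rw [sum_typeI_mul 1 fun m => ((orbitSum (charWeight m.1) w : ℤ) : ℂ), sub_eq_zero]
    exact_mod_cast orbitSum_charWeight_char00 w
  have h' := h τ hτ
  rwa [sum_typeI_mul 1 fun m => thetaProd m τ, sub_eq_zero] at h'

theorem thetaProd_typeI (σ : Equiv.Perm (Fin 3)) {τ : Matrix (Fin 2) (Fin 2) ℂ}
    (hτ : τ ∈ SiegelHalfSpace 2) :
    thetaProd char00 τ = ∑ i, thetaProd (matA i (σ i)) τ := by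
  have h : ∀ i j, thetaProd (matA i j) τ =
      thetaProd (matA i 0) τ + thetaProd (matA 0 j) τ - thetaProd (matA 0 0) τ :=
    fun i j => eq_sub_of_add_eq (thetaProd_matA_add hτ i j)
  rw [thetaProd_char00 hτ, Finset.sum_congr rfl fun i _ => h i i,
    Finset.sum_congr rfl fun i _ => h i (σ i)]
  simp only [Finset.sum_sub_distrib, Finset.sum_add_distrib]
  rw [Equiv.sum_comp σ fun j => thetaProd (matA 0 j) τ]

theorem thetaProd_typeII (i k j l : Fin 3) {τ : Matrix (Fin 2) (Fin 2) ℂ}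
    (hτ : τ ∈ SiegelHalfSpace 2) :
    thetaProd (matA i j) τ + thetaProd (matA k l) τ =
      thetaProd (matA i l) τ + thetaProd (matA k j) τ := by
  linear_combination thetaProd_matA_add hτ i j + thetaProd_matA_add hτ k l
    - thetaProd_matA_add hτ i l - thetaProd_matA_add hτ k j

theorem theorem4p4 :
    -- Type I: every generalized diagonal of `A`
    (∀ σ : Equiv.Perm (Fin 3), ∀ τ ∈ SiegelHalfSpace 2,
      thetaProd char00 τ = ∑ i, thetaProd (matA i (σ i)) τ) ∧
    -- Type II: every `2 × 2` submatrix of `A`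
    (∀ i k j l : Fin 3, i ≠ k → j ≠ l → ∀ τ ∈ SiegelHalfSpace 2,
      thetaProd (matA i j) τ + thetaProd (matA k l) τ =
        thetaProd (matA i l) τ + thetaProd (matA k j) τ) ∧
    -- the two displayed examples
    (∀ τ ∈ SiegelHalfSpace 2,
      thetaConst 0 0 τ * thetaConst 0 0 ((3 : ℂ) • τ) =
        thetaConst 1 1 τ * thetaConst 1 1 ((3 : ℂ) • τ)
          + thetaConst 2 0 τ * thetaConst 2 0 ((3 : ℂ) • τ)
          + thetaConst 1 2 τ * thetaConst 1 2 ((3 : ℂ) • τ)) ∧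
    (∀ τ ∈ SiegelHalfSpace 2,
      thetaConst 1 1 τ * thetaConst 1 1 ((3 : ℂ) • τ)
          + thetaConst 2 0 τ * thetaConst 2 0 ((3 : ℂ) • τ) =
        thetaConst 0 1 τ * thetaConst 0 1 ((3 : ℂ) • τ)
          + thetaConst 2 2 τ * thetaConst 2 2 ((3 : ℂ) • τ)) ∧
    -- the relations among the ten products are exactly the combinations of these two types
    (∀ c : EvenChar → ℂ, IsThetaRelation c ↔
      c ∈ Submodule.span ℂ
        (Set.range typeI ∪
          {v | ∃ i k j l : Fin 3, i ≠ k ∧ j ≠ l ∧ v = typeII i k j l})) := by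
  refine ⟨fun σ τ hτ => thetaProd_typeI σ hτ, fun i k j l _ _ τ hτ => thetaProd_typeII i k j l hτ,
    fun τ hτ => ?_, fun τ hτ => thetaProd_typeII 0 1 0 1 hτ, fun c => ⟨fun hc =>
      mem_span_of_forall_orbitSum c (forall_orbitSum_of_isThetaRelation hc), fun hc τ hτ => ?_⟩⟩
  · have h := thetaProd_char00 hτ
    rwa [Fin.sum_univ_three] at h
  · induction hc using Submodule.span_induction with
    | mem v hv =>
      rcases hv with ⟨σ, rfl⟩ | ⟨i, k, j, l, _, _, rfl⟩
      · rw [sum_typeI_mul σ fun m => thetaProd m τ, thetaProd_typeI σ hτ, sub_self]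
      · rw [sum_typeII_mul i k j l fun m => thetaProd m τ, thetaProd_typeII i k j l hτ, sub_self]
    | zero => simp
    | add u v _ _ hu hv =>
      simp only [Pi.add_apply, add_mul, Finset.sum_add_distrib, hu, hv, add_zero]
    | smul a u _ hu =>
      simp only [Pi.smul_apply, smul_eq_mul, mul_assoc, ← Finset.mul_sum, hu, mul_zero]
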